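/- Let $H_1,\dots,H_d$ be Hilbert spaces (all real or all complex), and let $\mathbf H=H_1\otimes\cdots\otimes H_d$ be their Hilbert space tensor product (with the induced inner product). Fix $t\subseteq\{1,\dots,d\}$ with $0<|t|<d$, put $t^c=\{1,\dots,d\}\setminus t$, and identify $\mathbf H$ with $\mathbf H_t\otimes\mathbf H_{t^c}$, where $\mathbf H_t=\bigotimes_{\mu\in t}H_\mu$ and $\mathbf H_{t^c}=\bigotimes_{\mu\in t^c}H_\mu$. The $t$-rank $\operatorname{rank}^{(t)}(\mathbf v)$ of $\mathbf v\in\mathbf H$ is the rank of the Hilbert--Schmidt operator between $\mathbf H_t$ and $\mathbf H_{t^c}$ associated with $\mathbf v$, and $\tau_r^{(t)}(\mathbf v)=\inf\{\|\mathbf v-\mathbf w\| : \operatorname{rank}^{(t)}(\mathbf w)\le r\}$. Let $\mathbf A$ be a bounded self-adjoint operator on $\mathbf H$ with $$\gamma\|\mathbf v\|^2\le\langle\mathbf v,\mathbf A\mathbf v\rangle\le\Gamma\|\mathbf v\|^2\qquad\text{for all }\mathbf v\in\mathbf H,$$ where $0<\gamma<\Gamma<\infty$. Suppose that $$\mathbf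 A=\sum_{i=1}^{r_{\mathbf A}}A_i^{(t)}\otimes A_i^{(t^c)},\qquad \mathbf b=\sum_{j=1}^{r_{\mathbf b}}b_j^{(t)}\otimes b_j^{(t^c)},\qquad r_{\mathbf b}\le r_{\mathbf A},$$ with bounded operators $A_i^{(t)}$ on $\mathbf H_t$ and $A_i^{(t^c)}$ on $\mathbf H_{t^c}$, and with $b_j^{(t)}\in\mathbf H_t$, $b_j^{(t^c)}\in\mathbf H_{t^c}$. Put $\kappa=\Gamma/\gamma$ and $q=\frac{\kappa-1}{\kappa+1}$. Then the solution $\mathbf u$ of $\mathbf A\mathbf u=\mathbf b$ satisfies, for every integer $r\ge1$, $$\tau_r^{(t)}(\mathbf u)\le\frac{\|\mathbf u\|}{q}\left(\frac1r\right)^{\left|\frac{\ln q}{\ln R}\right|}$$ with $R=r_{\mathbf A}+2$. If, additionally, $A_i^{(t)}$ or $A_i^{(t^c)}$ is the identity for some $i$, then the same bound holds with $R=r_{\mathbf A}+1$. -/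

import Mathlib

open scoped TensorProduct InnerProductSpace

noncomputable section

namespace HilbertTensor

universe u v w

/-! ### The Hilbert tensor product of finitely many Hilbert spaces -/

section Family

variable (𝕜 : Type u) [RCLike 𝕜] {ι : Type v} (H : ι → Type w)
  [∀ i, NormedAddCommGroup (H i)] [∀ i, InnerProductSpace 𝕜 (H i)]

/-- The algebraic tensor product `⨂ i, H i`. It is a type of its own because the norm it gets
below is the one of the induced inner product, and not the projective one. -/
def Alg : Type (max u v w) := PiTensorProduct 𝕜 H

instance : AddCommGroup (Alg 𝕜 H) := inferInstanceAs (AddCommGroup (PiTensorProduct 𝕜 H))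

instance : Module 𝕜 (Alg 𝕜 H) := inferInstanceAs (Module 𝕜 (PiTensorProduct 𝕜 H))

variable {H}

/-- The elementary tensor `⨂ i, f i` in the algebraic tensor product. -/
def Alg.tprod (f : ∀ i, H i) : Alg 𝕜 H := PiTensorProduct.tprod 𝕜 f

variable {𝕜}

theorem Alg.span_tprod : Submodule.span 𝕜 (Set.range (Alg.tprod 𝕜 (H := H))) = ⊤ :=
  PiTensorProduct.span_tprod_eq_top

theorem Alg.induction {p : Alg 𝕜 H → Prop} (h0 : p 0)
    (ht : ∀ f, p (Alg.tprod 𝕜 f)) (ha : ∀ x y, p x → p y → p (x + y))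
    (hs : ∀ (c : 𝕜) x, p x → p (c • x)) (x : Alg 𝕜 H) : p x := by
  have hx : x ∈ Submodule.span 𝕜 (Set.range (Alg.tprod 𝕜 (H := H))) := by
    rw [Alg.span_tprod]; trivial
  induction hx using Submodule.span_induction with
  | mem y hy => obtain ⟨f, rfl⟩ := hy; exact ht f
  | zero => exact h0
  | add y z _ _ hy hz => exact ha y z hy hz
  | smul c y _ hy => exact hs c y hy

open scoped ComplexOrder in
theorem posSemidef_inner {X E : Type*} [NormedAddCommGroup E] [InnerProductSpace 𝕜 E]
    (v : X → E) : (Matrix.of fun x y => inner 𝕜 (v x) (v y)).PosSemidef := by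
  refine ⟨Matrix.IsHermitian.ext fun x y => inner_conj_symm _ _, fun c => ?_⟩
  have h : (c.sum fun i a => c.sum fun j b =>
      star a * (Matrix.of fun x y => inner 𝕜 (v x) (v y)) i j * b) =
        inner 𝕜 (c.sum fun i a => a • v i) (c.sum fun i a => a • v i) := by
    simp only [Finsupp.sum, sum_inner, inner_sum, inner_smul_left, inner_smul_right,
      Matrix.of_apply]
    rw [Finset.sum_comm]
    refine Finset.sum_congr rfl fun i _ => ?_
    rw [Finset.mul_sum]
    refine Finset.sum_congr rfl fun j _ => ?_
    rw [RCLike.star_def]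
    ring
  rw [h, inner_self_eq_norm_sq_to_K]
  exact_mod_cast sq_nonneg ‖c.sum fun i a => a • v i‖

open scoped ComplexOrder in
theorem Alg.posSemidef_prod (s : Finset ι) :
    (Matrix.of fun f g : ∀ i, H i => ∏ i ∈ s, inner 𝕜 (f i) (g i)).PosSemidef := by
  classical
  induction s using Finset.induction_on with
  | empty =>
    convert posSemidef_inner (𝕜 := 𝕜) (fun _ : ∀ i, H i => (1 : 𝕜)) using 1
    ext f g
    simp
  | insert a s ha ih =>
    convert (posSemidef_inner (𝕜 := 𝕜) (fun f : ∀ i, H i => f a)).hadamard ih using 1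
    ext f g
    simp [Finset.prod_insert ha]

variable [Fintype ι]

/-- The linear functional `⨂ f i ↦ ∏ i, ⟪g i, f i⟫`. -/
def Alg.pairing (g : ∀ i, H i) : Alg 𝕜 H →ₗ[𝕜] 𝕜 :=
  PiTensorProduct.lift
    ((MultilinearMap.mkPiAlgebra 𝕜 ι 𝕜).compLinearMap fun i => innerₛₗ 𝕜 (g i))

theorem Alg.pairing_tprod (g f : ∀ i, H i) :
    Alg.pairing g (Alg.tprod 𝕜 f) = ∏ i, inner 𝕜 (g i) (f i) := by
  rw [Alg.pairing, Alg.tprod]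
  erw [PiTensorProduct.lift.tprod]
  simp

theorem Alg.pairing_update_add [DecidableEq ι] (m : ∀ i, H i) (i : ι) (a b : H i)
    (x : Alg 𝕜 H) :
    Alg.pairing (Function.update m i (a + b)) x =
      Alg.pairing (Function.update m i a) x + Alg.pairing (Function.update m i b) x := by
  induction x using Alg.induction with
  | h0 => simp
  | ht f =>
    simp only [Alg.pairing_tprod, ← Finset.mul_prod_erase _ _ (Finset.mem_univ i),
      Function.update_self, inner_add_left, add_mul]
    congr 2 <;> refine Finset.prod_congr rfl fun j hj => ?_ <;>
      simp [Function.update_of_ne (Finset.ne_of_mem_erase hj)]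
  | ha x y hx hy => rw [map_add, hx, hy, map_add, map_add]; ring
  | hs c x hx => rw [map_smul, hx, map_smul, map_smul, smul_add]

theorem Alg.pairing_update_smul [DecidableEq ι] (m : ∀ i, H i) (i : ι) (c : 𝕜) (a : H i)
    (x : Alg 𝕜 H) :
    Alg.pairing (Function.update m i (c • a)) x =
      star c * Alg.pairing (Function.update m i a) x := by
  induction x using Alg.induction with
  | h0 => simp
  | ht f =>
    simp only [Alg.pairing_tprod, ← Finset.mul_prod_erase _ _ (Finset.mem_univ i),
      Function.update_self, inner_smul_left, mul_assoc]
    congr 2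
    refine Finset.prod_congr rfl fun j hj => ?_
    simp [Function.update_of_ne (Finset.ne_of_mem_erase hj)]
  | ha x y hx hy => rw [map_add, hx, hy, map_add]; ring
  | hs c' x hx => rw [map_smul, hx, map_smul, smul_eq_mul, smul_eq_mul]; ring

/-- The linear functional `⨂ g i ↦ ⟪x, ⨂ g i⟫`. -/
def Alg.innerRight (x : Alg 𝕜 H) : Alg 𝕜 H →ₗ[𝕜] 𝕜 :=
  PiTensorProduct.lift
    { toFun := fun g => star (Alg.pairing g x)
      map_update_add' := fun m i a b => by rw [Alg.pairing_update_add, star_add]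
      map_update_smul' := fun m i c a => by
        rw [Alg.pairing_update_smul, star_mul', star_star, smul_eq_mul] }

theorem Alg.innerRight_tprod (x : Alg 𝕜 H) (g : ∀ i, H i) :
    Alg.innerRight x (Alg.tprod 𝕜 g) = star (Alg.pairing g x) := by
  rw [Alg.innerRight, Alg.tprod]
  erw [PiTensorProduct.lift.tprod]
  rfl

theorem Alg.innerRight_tprod_tprod (f g : ∀ i, H i) :
    Alg.innerRight (Alg.tprod 𝕜 f) (Alg.tprod 𝕜 g) = ∏ i, inner 𝕜 (f i) (g i) := by
  rw [Alg.innerRight_tprod, Alg.pairing_tprod, star_prod]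
  exact Finset.prod_congr rfl fun i _ => inner_conj_symm _ _

theorem Alg.innerRight_add (x y z : Alg 𝕜 H) :
    Alg.innerRight (x + y) z = Alg.innerRight x z + Alg.innerRight y z := by
  induction z using Alg.induction with
  | h0 => simp
  | ht f => simp only [Alg.innerRight_tprod, map_add, star_add]
  | ha a b ha hb => rw [map_add, ha, hb, map_add, map_add]; ring
  | hs c a ha => rw [map_smul, ha, map_smul, map_smul, smul_add]

theorem Alg.innerRight_smul (c : 𝕜) (x z : Alg 𝕜 H) :
    Alg.innerRight (c • x) z = star c * Alg.innerRight x z := by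
  induction z using Alg.induction with
  | h0 => simp
  | ht f => simp only [Alg.innerRight_tprod, map_smul, smul_eq_mul, star_mul']
  | ha a b ha hb => rw [map_add, ha, hb, map_add]; ring
  | hs d a ha => rw [map_smul, ha, map_smul, smul_eq_mul, smul_eq_mul]; ring

theorem Alg.innerRight_symm (x y : Alg 𝕜 H) :
    star (Alg.innerRight y x) = Alg.innerRight x y := by
  have h0 : ∀ z : Alg 𝕜 H, Alg.innerRight 0 z = 0 := fun z => by
    simpa using Alg.innerRight_smul (0 : 𝕜) 0 z
  induction y using Alg.induction with
  | h0 => simp [h0]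
  | ht g =>
    induction x using Alg.induction with
    | h0 => simp [h0]
    | ht f =>
      rw [Alg.innerRight_tprod, star_star, Alg.pairing_tprod, Alg.innerRight_tprod_tprod]
    | ha a b ha hb => rw [map_add, star_add, ha, hb, Alg.innerRight_add]
    | hs c a ha => rw [map_smul, smul_eq_mul, star_mul', ha, Alg.innerRight_smul]
  | ha a b ha hb => rw [Alg.innerRight_add, star_add, ha, hb, map_add]
  | hs c a ha =>
    rw [Alg.innerRight_smul, star_mul', star_star, ha, map_smul, smul_eq_mul]

theorem Alg.innerRight_self_nonneg (x : Alg 𝕜 H) : 0 ≤ RCLike.re (Alg.innerRight x x) := by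
  have hx : x ∈ Submodule.span 𝕜 (Set.range (Alg.tprod 𝕜 (H := H))) := by
    rw [Alg.span_tprod]; trivial
  obtain ⟨c, rfl⟩ := (Finsupp.mem_span_range_iff_exists_finsupp).1 hx
  have key := (RCLike.nonneg_iff.1 ((Alg.posSemidef_prod (𝕜 := 𝕜) (H := H) Finset.univ).2 c)).1
  refine key.trans_eq (congrArg _ ?_)
  simp only [Finsupp.sum, Matrix.of_apply]
  have hl : ∀ (s : Finset (∀ i, H i)) (z : Alg 𝕜 H),
      Alg.innerRight (∑ f ∈ s, c f • Alg.tprod 𝕜 f) z =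
        ∑ f ∈ s, star (c f) * Alg.innerRight (Alg.tprod 𝕜 f) z := by
    classical
    intro s z
    induction s using Finset.induction_on with
    | empty => simpa using Alg.innerRight_smul (0 : 𝕜) 0 z
    | insert a s ha ih =>
      rw [Finset.sum_insert ha, Finset.sum_insert ha, Alg.innerRight_add, ih,
        Alg.innerRight_smul]
  rw [hl]
  refine Finset.sum_congr rfl fun f _ => ?_
  rw [map_sum, Finset.mul_sum]
  refine Finset.sum_congr rfl fun g _ => ?_
  rw [map_smul, Alg.innerRight_tprod_tprod, smul_eq_mul]
  ring

variable (𝕜 H)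

/-- The induced inner product, `⟪⨂ f i, ⨂ g i⟫ = ∏ i, ⟪f i, g i⟫`. -/
@[reducible]
def Alg.core : PreInnerProductSpace.Core 𝕜 (Alg 𝕜 H) where
  inner x y := Alg.innerRight x y
  conj_inner_symm x y := Alg.innerRight_symm x y
  re_inner_nonneg x := Alg.innerRight_self_nonneg x
  add_left x y z := Alg.innerRight_add x y z
  smul_left x y r := Alg.innerRight_smul r x y

instance : SeminormedAddCommGroup (Alg 𝕜 H) :=
  @InnerProductSpace.Core.toSeminormedAddCommGroup 𝕜 (Alg 𝕜 H) _ _ _ (Alg.core 𝕜 H)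

instance : InnerProductSpace 𝕜 (Alg 𝕜 H) := InnerProductSpace.ofCore (Alg.core 𝕜 H)

/-- The Hilbert space `⨂ i, H i`: the completion of the algebraic tensor product with respect to
the induced inner product. -/
abbrev Space : Type (max u v w) := UniformSpace.Completion (Alg 𝕜 H)

variable {H}

/-- The elementary tensor `⨂ i, f i` in the Hilbert tensor product. -/
def tprod (f : ∀ i, H i) : Space 𝕜 H := (Alg.tprod 𝕜 f : Alg 𝕜 H)

variable {𝕜}

theorem Alg.inner_tprod (f g : ∀ i, H i) :
    inner 𝕜 (Alg.tprod 𝕜 f) (Alg.tprod 𝕜 g) = ∏ i, inner 𝕜 (f i) (g i) :=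
  Alg.innerRight_tprod_tprod f g

theorem inner_tprod (f g : ∀ i, H i) :
    inner 𝕜 (tprod 𝕜 f) (tprod 𝕜 g) = ∏ i, inner 𝕜 (f i) (g i) := by
  rw [tprod, tprod, UniformSpace.Completion.inner_coe, Alg.inner_tprod]

end Family

/-! ### The Hilbert tensor product of two Hilbert spaces -/

section Two

variable (𝕜 : Type u) [RCLike 𝕜] (E : Type v) (F : Type w)
  [NormedAddCommGroup E] [InnerProductSpace 𝕜 E]
  [NormedAddCommGroup F] [InnerProductSpace 𝕜 F]

/-- The Hilbert space `E ⊗ F`. -/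
abbrev Space₂ : Type (max v w) := UniformSpace.Completion (E ⊗[𝕜] F)

/-- The elementary tensor `a ⊗ b` as a bounded bilinear map. -/
def mkL : E →L[𝕜] F →L[𝕜] Space₂ 𝕜 E F :=
  (ContinuousLinearMap.compL 𝕜 F (E ⊗[𝕜] F) (Space₂ 𝕜 E F)
    (UniformSpace.Completion.toComplL : (E ⊗[𝕜] F) →L[𝕜] Space₂ 𝕜 E F)).comp
    (TensorProduct.mkL 𝕜 E F)

variable {𝕜 E F}

theorem mkL_apply (a : E) (b : F) : mkL 𝕜 E F a b = ((a ⊗ₜ[𝕜] b : E ⊗[𝕜] F) : Space₂ 𝕜 E F) :=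
  rfl

/-- The operator `S ⊗ T` on `E ⊗ F`. -/
def op₂ (S : E →L[𝕜] E) (T : F →L[𝕜] F) : Space₂ 𝕜 E F →L[𝕜] Space₂ 𝕜 E F :=
  (TensorProduct.mapL S T).completion

variable [CompleteSpace F]

/-- The Hilbert-Schmidt operator of `x ∈ E ⊗ F`. It is the conjugate-linear operator from `E` to
`F` with `⟪b, T a⟫ = ⟪a ⊗ b, x⟫`; the operator of `a' ⊗ b'` maps `a` to `⟪a, a'⟫ b'`. -/
def hsOp (x : Space₂ 𝕜 E F) : E →ₗ⋆[𝕜] F where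
  toFun a := ContinuousLinearMap.adjoint (mkL 𝕜 E F a) x
  map_add' a b := by simp
  map_smul' c a := by rw [map_smul, map_smulₛₗ]; rfl

theorem inner_hsOp (x : Space₂ 𝕜 E F) (a : E) (b : F) :
    inner 𝕜 b (hsOp x a) = inner 𝕜 (mkL 𝕜 E F a b) x := by
  simp [hsOp, ContinuousLinearMap.adjoint_inner_right]

theorem hsOp_mkL (a a' : E) (b' : F) :
    hsOp (mkL 𝕜 E F a' b') a = inner 𝕜 a a' • b' := by
  refine ext_inner_left 𝕜 fun b => ?_
  rw [inner_hsOp, mkL_apply, mkL_apply, UniformSpace.Completion.inner_coe,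
    TensorProduct.inner_tmul, inner_smul_right]

/-- The rank of `x ∈ E ⊗ F`, i.e. the rank of its Hilbert-Schmidt operator; `⊤` if infinite. -/
def rank₂ (x : Space₂ 𝕜 E F) : ℕ∞ :=
  Cardinal.toENat (Module.rank 𝕜 (LinearMap.range (hsOp x)))

end Two

/-! ### Splitting the factors into those in `t` and those in the complement of `t` -/

section Split

variable {𝕜 : Type u} [RCLike 𝕜] {ι : Type v} [Fintype ι] [DecidableEq ι] {H : ι → Type w}
  [∀ i, NormedAddCommGroup (H i)] [∀ i, InnerProductSpace 𝕜 (H i)]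

variable (𝕜 H) in
/-- The Hilbert space `⨂ i ∈ t, H i`. -/
abbrev Part (t : Finset ι) : Type (max u v w) := Space 𝕜 (fun i : t => H i)

/-- `t` and its complement make up the whole index set. -/
def sumEquiv (t : Finset ι) : t ⊕ (tᶜ : Finset ι) ≃ ι :=
  (Equiv.sumCongr (Equiv.refl _)
    (Equiv.subtypeEquivRight fun _ => Finset.mem_compl)).trans (Equiv.sumCompl (· ∈ t))

variable (𝕜 H) in
/-- The algebraic isomorphism `⨂ i, H i ≃ (⨂ i ∈ t, H i) ⊗ (⨂ i ∉ t, H i)`. -/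
def algSplit (t : Finset ι) :
    Alg 𝕜 H ≃ₗ[𝕜]
      Alg 𝕜 (fun i : t => H i) ⊗[𝕜] Alg 𝕜 (fun i : (tᶜ : Finset ι) => H i) :=
  (PiTensorProduct.reindex 𝕜 H (sumEquiv t).symm).trans
    (PiTensorProduct.tmulEquivDep 𝕜 (fun s => H (sumEquiv t s))).symm

theorem algSplit_tprod (t : Finset ι) (f : ∀ i, H i) :
    algSplit 𝕜 H t (Alg.tprod 𝕜 f) =
      Alg.tprod 𝕜 (fun i : t => f i) ⊗ₜ[𝕜]
        Alg.tprod 𝕜 (fun i : (tᶜ : Finset ι) => f i) := by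
  unfold algSplit Alg.tprod
  erw [LinearEquiv.trans_apply, PiTensorProduct.reindex_tprod,
    PiTensorProduct.tmulEquivDep_symm_apply]
  rfl

variable (𝕜 H) in
/-- The canonical map of the algebraic into the Hilbert tensor product of the two parts. -/
def partsIncl (t : Finset ι) :
    Alg 𝕜 (fun i : t => H i) ⊗[𝕜] Alg 𝕜 (fun i : (tᶜ : Finset ι) => H i) →ₗ[𝕜]
      Space₂ 𝕜 (Part 𝕜 H t) (Part 𝕜 H tᶜ) :=
  (UniformSpace.Completion.toComplL (𝕜 := 𝕜)
      (E := Part 𝕜 H t ⊗[𝕜] Part 𝕜 H tᶜ)).toLinearMap ∘ₗ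
    TensorProduct.map
      (UniformSpace.Completion.toComplL (𝕜 := 𝕜) (E := Alg 𝕜 (fun i : t => H i))).toLinearMap
      (UniformSpace.Completion.toComplL (𝕜 := 𝕜)
        (E := Alg 𝕜 (fun i : (tᶜ : Finset ι) => H i))).toLinearMap

theorem denseRange_partsIncl (t : Finset ι) : DenseRange (partsIncl 𝕜 H t) := by
  let M := (LinearMap.range (partsIncl 𝕜 H t)).topologicalClosure
  have hM : IsClosed (M : Set (Space₂ 𝕜 (Part 𝕜 H t) (Part 𝕜 H tᶜ))) :=
    Submodule.isClosed_topologicalClosure _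
  have h1 : ∀ (a : Part 𝕜 H t) (b : Part 𝕜 H tᶜ), mkL 𝕜 _ _ a b ∈ M := by
    intro a b
    induction a, b using UniformSpace.Completion.induction_on₂ with
    | hp => exact hM.preimage (mkL 𝕜 (Part 𝕜 H t) (Part 𝕜 H tᶜ)).continuous₂
    | ih x y => exact Submodule.le_topologicalClosure _ ⟨x ⊗ₜ[𝕜] y, rfl⟩
  have h2 : ∀ z : Part 𝕜 H t ⊗[𝕜] Part 𝕜 H tᶜ,
      (z : Space₂ 𝕜 (Part 𝕜 H t) (Part 𝕜 H tᶜ)) ∈ M := by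
    intro z
    induction z using TensorProduct.induction_on with
    | zero => rw [UniformSpace.Completion.coe_zero]; exact M.zero_mem
    | tmul a b => exact h1 a b
    | add x y hx hy => rw [UniformSpace.Completion.coe_add]; exact M.add_mem hx hy
  intro z
  induction z using UniformSpace.Completion.induction_on with
  | hp => exact hM
  | ih z => exact h2 z

theorem inner_partsIncl (t : Finset ι) (x y : Alg 𝕜 H) :
    inner 𝕜 (partsIncl 𝕜 H t (algSplit 𝕜 H t x)) (partsIncl 𝕜 H t (algSplit 𝕜 H t y)) =
      inner 𝕜 x y := by
  induction x using Alg.induction with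
  | h0 => simp
  | ht f =>
    induction y using Alg.induction with
    | h0 => simp
    | ht g =>
      rw [algSplit_tprod, algSplit_tprod, Alg.inner_tprod]
      simp only [partsIncl, LinearMap.comp_apply, TensorProduct.map_tmul,
        ContinuousLinearMap.coe_coe, UniformSpace.Completion.coe_toComplL,
        UniformSpace.Completion.inner_coe, TensorProduct.inner_tmul, Alg.inner_tprod]
      rw [Finset.prod_coe_sort t (fun i => inner 𝕜 (f i) (g i)),
        Finset.prod_coe_sort tᶜ (fun i => inner 𝕜 (f i) (g i)), Finset.prod_mul_prod_compl]
    | ha a b ha hb => simp only [map_add, inner_add_right, ha, hb]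
    | hs c a ha => simp only [map_smul, inner_smul_right, ha]
  | ha a b ha hb => simp only [map_add, inner_add_left, ha, hb]
  | hs c a ha => simp only [map_smul, inner_smul_left, ha]

variable (𝕜 H) in
/-- The isometric isomorphism `⨂ i, H i ≃ (⨂ i ∈ t, H i) ⊗ (⨂ i ∉ t, H i)`. -/
def split (t : Finset ι) : Space 𝕜 H ≃ₗᵢ[𝕜] Space₂ 𝕜 (Part 𝕜 H t) (Part 𝕜 H tᶜ) :=
  (algSplit 𝕜 H t).extendOfIsometry
    (UniformSpace.Completion.toComplL (𝕜 := 𝕜) (E := Alg 𝕜 H)).toLinearMap (partsIncl 𝕜 H t)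
    UniformSpace.Completion.denseRange_coe (denseRange_partsIncl t) fun x => by
      rw [@norm_eq_sqrt_re_inner 𝕜, inner_partsIncl, ← @norm_eq_sqrt_re_inner 𝕜]
      exact (UniformSpace.Completion.norm_coe x).symm

theorem split_tprod (t : Finset ι) (f : ∀ i, H i) :
    split 𝕜 H t (tprod 𝕜 f) =
      mkL 𝕜 _ _ (tprod 𝕜 fun i : t => f i) (tprod 𝕜 fun i : (tᶜ : Finset ι) => f i) := by
  refine (LinearEquiv.extendOfIsometry_eq _ _ _ _ _ _ _).trans ?_
  rw [algSplit_tprod]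
  rfl

/-- The tensor `a ⊗ b` for `a` in the `t`-part and `b` in the complementary part. -/
def tmul (t : Finset ι) (a : Part 𝕜 H t) (b : Part 𝕜 H tᶜ) : Space 𝕜 H :=
  (split 𝕜 H t).symm (mkL 𝕜 _ _ a b)

/-- The operator `S ⊗ T` for `S` acting on the `t`-part and `T` on the complementary part. -/
def tensorOp (t : Finset ι) (S : Part 𝕜 H t →L[𝕜] Part 𝕜 H t)
    (T : Part 𝕜 H tᶜ →L[𝕜] Part 𝕜 H tᶜ) : Space 𝕜 H →L[𝕜] Space 𝕜 H :=
  (split 𝕜 H t).symm.toContinuousLinearEquiv.toContinuousLinearMap ∘L op₂ S T ∘L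
    (split 𝕜 H t).toContinuousLinearEquiv.toContinuousLinearMap

theorem tensorOp_tmul (t : Finset ι) (S : Part 𝕜 H t →L[𝕜] Part 𝕜 H t)
    (T : Part 𝕜 H tᶜ →L[𝕜] Part 𝕜 H tᶜ) (a : Part 𝕜 H t) (b : Part 𝕜 H tᶜ) :
    tensorOp t S T (tmul t a b) = tmul t (S a) (T b) := by
  simp [tensorOp, tmul, op₂, mkL_apply]

/-- The `t`-rank of a tensor: the rank of the Hilbert-Schmidt operator between the two parts. -/
def tRank (t : Finset ι) (x : Space 𝕜 H) : ℕ∞ := rank₂ (split 𝕜 H t x)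

/-- The error `τ_r^{(t)}(x)` of the best approximation by tensors of `t`-rank at most `r`. -/
def tau (t : Finset ι) (r : ℕ) (x : Space 𝕜 H) : ℝ :=
  ⨅ y : {y : Space 𝕜 H // tRank t y ≤ r}, ‖x - y‖

end Split

end HilbertTensor

end

open scoped TensorProduct InnerProductSpace

namespace HilbertTensor

universe u v w

/-! ### Rank calculus for Hilbert–Schmidt operators -/

section RankTwo

variable {𝕜 : Type u} [RCLike 𝕜] {E : Type v} {F : Type w}
  [NormedAddCommGroup E] [InnerProductSpace 𝕜 E]
  [NormedAddCommGroup F] [InnerProductSpace 𝕜 F]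

/-! The approximants are Richardson iterates started at zero. With step size `2 / (γ + Γ)` the error
after `k` steps is at most `q ^ k * ‖u‖` (`norm_sub_richardson_le`). The `t`-rank is subadditive,
and `S ⊗ T` does not raise it, so one step takes rank `ρ` to at most `ρ + rA * ρ + rb`. As `rb ≤
rA`, the quantity `ρ + 1` grows at most by the factor `rA + 1` (`tRank_richardson_add_one_le`).

For `R ≥ rA + 1` with `R > 1`, take `k = ⌊log_R r⌋`: the iterate has rank at most `r`. Since `r < R
^ (k + 1)`, the power `q ^ (k + 1)` is at most the algebraic rate in `r`
(`pow_log_succ_le_one_div_rpow`); rounding down costs the factor `1 / q`. -/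

theorem op₂_mkL (S : E →L[𝕜] E) (T : F →L[𝕜] F) (a : E) (b : F) :
    op₂ S T (mkL 𝕜 E F a b) = mkL 𝕜 E F (S a) (T b) := by
  simp [op₂, mkL_apply]

variable [CompleteSpace F]

theorem hsOp_zero : hsOp (0 : Space₂ 𝕜 E F) = 0 := by
  ext a
  simp [hsOp]

theorem hsOp_add (x y : Space₂ 𝕜 E F) : hsOp (x + y) = hsOp x + hsOp y := by
  ext a
  simp [hsOp]

theorem hsOp_smul (c : 𝕜) (x : Space₂ 𝕜 E F) : hsOp (c • x) = c • hsOp x := by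
  ext a
  simp [hsOp]

/-- The adjoint of `S ⊗ T` is `S† ⊗ T†`, tested against an elementary tensor. -/
theorem inner_mkL_op₂ [CompleteSpace E] (S : E →L[𝕜] E) (T : F →L[𝕜] F) (a : E) (b : F)
    (x : Space₂ 𝕜 E F) :
    inner 𝕜 (mkL 𝕜 E F a b) (op₂ S T x) = inner 𝕜
      (mkL 𝕜 E F (ContinuousLinearMap.adjoint S a) (ContinuousLinearMap.adjoint T b)) x := by
  induction x using UniformSpace.Completion.induction_on with
  | hp => exact isClosed_eq (by fun_prop) (by fun_prop)
  | ih z =>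
    induction z using TensorProduct.induction_on with
    | zero =>
      rw [UniformSpace.Completion.coe_zero, map_zero, inner_zero_right, inner_zero_right]
    | tmul c d =>
      rw [← mkL_apply, op₂_mkL]
      simp only [mkL_apply, UniformSpace.Completion.inner_coe, TensorProduct.inner_tmul,
        ContinuousLinearMap.adjoint_inner_left]
    | add y z hy hz =>
      rw [UniformSpace.Completion.coe_add, map_add, inner_add_right, inner_add_right, hy, hz]

/-- Testing against `b` moves both factors to the other side as adjoints. The operator thus factors
through that of `x`, which is what controls the rank under `S ⊗ T`. -/
theorem hsOp_op₂ [CompleteSpace E] (S : E →L[𝕜] E) (T : F →L[𝕜] F) (x : Space₂ 𝕜 E F) (a : E) :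
    hsOp (op₂ S T x) a = T (hsOp x (ContinuousLinearMap.adjoint S a)) := by
  refine ext_inner_left 𝕜 fun b => ?_
  rw [inner_hsOp, inner_mkL_op₂, ← ContinuousLinearMap.adjoint_inner_left, inner_hsOp]

theorem toENat_rank_mono {V : Type w} [AddCommGroup V] [Module 𝕜 V] {p q : Submodule 𝕜 V}
    (h : p ≤ q) :
    Cardinal.toENat (Module.rank 𝕜 p) ≤ Cardinal.toENat (Module.rank 𝕜 q) :=
  OrderHomClass.mono Cardinal.toENat (Submodule.rank_mono h)

theorem rank₂_zero : rank₂ (0 : Space₂ 𝕜 E F) = 0 := by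
  rw [rank₂, hsOp_zero, LinearMap.range_zero, rank_bot, map_zero]

theorem rank₂_add_le (x y : Space₂ 𝕜 E F) : rank₂ (x + y) ≤ rank₂ x + rank₂ y := by
  -- `toENat` is additive and monotone, so the inequality may be proved between cardinals.
  rw [rank₂, rank₂, rank₂, ← map_add]
  refine OrderHomClass.mono Cardinal.toENat (le_trans (Submodule.rank_mono ?_)
    (Submodule.rank_add_le_rank_add_rank _ _))
  rintro _ ⟨a, rfl⟩
  rw [hsOp_add]
  exact Submodule.add_mem_sup ⟨a, rfl⟩ ⟨a, rfl⟩

theorem rank₂_smul_le (c : 𝕜) (x : Space₂ 𝕜 E F) : rank₂ (c • x) ≤ rank₂ x := by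
  refine toENat_rank_mono ?_
  rintro _ ⟨a, rfl⟩
  rw [hsOp_smul]
  exact Submodule.smul_mem _ c ⟨a, rfl⟩

theorem rank₂_mkL_le (a : E) (b : F) : rank₂ (mkL 𝕜 E F a b) ≤ 1 := by
  have h : LinearMap.range (hsOp (mkL 𝕜 E F a b)) ≤ Submodule.span 𝕜 {b} := by
    rintro _ ⟨c, rfl⟩
    rw [hsOp_mkL]
    exact Submodule.smul_mem _ _ (Submodule.mem_span_singleton_self b)
  refine (toENat_rank_mono h).trans ?_
  have h1 := OrderHomClass.mono Cardinal.toENat (rank_span_le (R := 𝕜) ({b} : Set F))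
  simpa using h1

/-- Precomposing with the adjoint of `S` can only shrink the range, and applying `T` to a range
cannot raise its dimension. -/
theorem rank₂_op₂_le [CompleteSpace E] (S : E →L[𝕜] E) (T : F →L[𝕜] F) (x : Space₂ 𝕜 E F) :
    rank₂ (op₂ S T x) ≤ rank₂ x := by
  refine OrderHomClass.mono Cardinal.toENat (le_trans (Submodule.rank_mono ?_)
    (rank_map_le T.toLinearMap (LinearMap.range (hsOp x))))
  rintro _ ⟨a, rfl⟩
  rw [hsOp_op₂]
  exact ⟨_, ⟨_, rfl⟩, rfl⟩

end RankTwo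

/-! ### Transfer to the `t`-rank -/

section TRank

variable {𝕜 : Type u} [RCLike 𝕜] {ι : Type v} [Fintype ι] [DecidableEq ι] {H : ι → Type w}
  [∀ i, NormedAddCommGroup (H i)] [∀ i, InnerProductSpace 𝕜 (H i)] (t : Finset ι)

theorem tRank_zero : tRank t (0 : Space 𝕜 H) = 0 := by
  rw [tRank, map_zero, rank₂_zero]

theorem tRank_add_le (x y : Space 𝕜 H) : tRank t (x + y) ≤ tRank t x + tRank t y := by
  rw [tRank, map_add]
  exact rank₂_add_le _ _

theorem tRank_smul_le (c : 𝕜) (x : Space 𝕜 H) : tRank t (c • x) ≤ tRank t x := by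
  rw [tRank, map_smul]
  exact rank₂_smul_le _ _

theorem tRank_tmul_le (a : Part 𝕜 H t) (b : Part 𝕜 H tᶜ) : tRank t (tmul t a b) ≤ 1 := by
  rw [tRank, tmul, LinearIsometryEquiv.apply_symm_apply]
  exact rank₂_mkL_le a b

theorem tRank_tensorOp_le (S : Part 𝕜 H t →L[𝕜] Part 𝕜 H t)
    (T : Part 𝕜 H tᶜ →L[𝕜] Part 𝕜 H tᶜ) (x : Space 𝕜 H) :
    tRank t (tensorOp t S T x) ≤ tRank t x := by
  have h : split 𝕜 H t (tensorOp t S T x) = op₂ S T (split 𝕜 H t x) := by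
    simp [tensorOp]
  rw [tRank, h]
  exact rank₂_op₂_le S T _

theorem tRank_sum_le {α : Type*} (s : Finset α) (f : α → Space 𝕜 H) :
    tRank t (∑ i ∈ s, f i) ≤ ∑ i ∈ s, tRank t (f i) := by
  classical
  induction s using Finset.induction_on with
  | empty => simp [tRank_zero]
  | insert a s ha ih =>
    rw [Finset.sum_insert ha, Finset.sum_insert ha]
    exact (tRank_add_le t _ _).trans (by gcongr)

theorem tRank_sum_le_card_mul {α : Type*} [Fintype α] (f : α → Space 𝕜 H) {n : ℕ∞}
    (hf : ∀ i, tRank t (f i) ≤ n) : tRank t (∑ i, f i) ≤ Fintype.card α * n := by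
  refine (tRank_sum_le t _ f).trans ((Finset.sum_le_card_nsmul _ _ _ fun i _ => hf i).trans ?_)
  rw [nsmul_eq_mul, Finset.card_univ]

theorem tau_le_norm_sub {r : ℕ} {x y : Space 𝕜 H} (hy : tRank t y ≤ r) : tau t r x ≤ ‖x - y‖ :=
  ciInf_le ⟨0, by rintro _ ⟨z, rfl⟩; exact norm_nonneg _⟩
    (⟨y, hy⟩ : {y : Space 𝕜 H // tRank t y ≤ r})

end TRank

end HilbertTensor

/-! ### Convergence of the Richardson iteration -/

section Richardson

variable {𝕜 E : Type*} [RCLike 𝕜] [NormedAddCommGroup E] [InnerProductSpace 𝕜 E]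

/-- The Richardson iteration for `A u = b` with step size `c`, started at zero. -/
def richardson (A : E →L[𝕜] E) (b : E) (c : 𝕜) : ℕ → E
  | 0 => 0
  | k + 1 => richardson A b c k + c • (b - A (richardson A b c k))

/-- As the right-hand side is `A u`, each step applies `1 - c • A` to the error, and the zero start
makes the initial error `u`. -/
theorem sub_richardson (A : E →L[𝕜] E) (u : E) (c : 𝕜) (k : ℕ) :
    u - richardson A (A u) c k = ((1 - c • A) ^ k : E →L[𝕜] E) u := by
  induction k with
  | zero => simp [richardson]
  | succ k ih =>
    rw [pow_succ', mul_apply_eq_comp, ← ih]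
    simp [richardson, smul_sub]
    abel

/-- The step size `2 / (γ + Γ)` makes the Richardson iteration contract with the factor
`(Γ - γ) / (Γ + γ)`. -/
theorem norm_one_sub_smul_le {A : E →L[𝕜] E} (hA : A.IsSymmetric) {γ Γ : ℝ} (hγ : 0 < γ)
    (hγΓ : γ < Γ) (hlower : ∀ v, γ * ‖v‖ ^ 2 ≤ RCLike.re (inner 𝕜 v (A v)))
    (hupper : ∀ v, RCLike.re (inner 𝕜 v (A v)) ≤ Γ * ‖v‖ ^ 2) :
    ‖(1 - ((2 / (γ + Γ) : ℝ) : 𝕜) • A : E →L[𝕜] E)‖ ≤ (Γ - γ) / (Γ + γ) := by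
  have hs : Γ + γ ≠ 0 := by linarith
  set c : ℝ := 2 / (γ + Γ) with hc
  have hsymm : (1 - (c : 𝕜) • A : E →L[𝕜] E).IsSymmetric := by
    intro x y
    have := hA x y
    simp only [ContinuousLinearMap.coe_coe] at this ⊢
    simp [inner_sub_left, inner_sub_right, inner_smul_left, inner_smul_right, this]
  -- The norm of a symmetric operator is the supremum of its absolute Rayleigh quotients, so bounds
  -- on the quadratic form suffice.
  rw [ContinuousLinearMap.norm_eq_iSup_rayleighQuotient _ hsymm]
  refine ciSup_le fun v => ?_
  have hre : RCLike.re (inner 𝕜 ((1 - (c : 𝕜) • A : E →L[𝕜] E) v) v) =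
      ‖v‖ ^ 2 - c * RCLike.re (inner 𝕜 v (A v)) := by
    rw [inner_re_symm, sub_apply, one_apply_eq_self, smul_apply, inner_sub_right,
      inner_smul_right, map_sub, inner_self_eq_norm_sq, RCLike.re_ofReal_mul]
  rw [ContinuousLinearMap.rayleighQuotient, ContinuousLinearMap.reApplyInnerSelf_apply, hre,
    abs_div, abs_of_nonneg (sq_nonneg ‖v‖)]
  -- This form of the division bound includes `v = 0`, where the quotient is `0 / 0 = 0`.
  refine div_le_of_le_mul₀ (sq_nonneg _) (div_nonneg (by linarith) (by linarith)) ?_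
  -- The choice of `c` balances the two ends: `1 - c * s` runs from `q` at `s = γ` to `-q` at `s =
  -- Γ`, where `q = (Γ - γ) / (Γ + γ)`.
  have hq1 : (Γ - γ) / (Γ + γ) = 1 - c * γ := by
    rw [hc, add_comm γ]; field_simp; ring
  have hq2 : (Γ - γ) / (Γ + γ) = c * Γ - 1 := by
    rw [hc, add_comm γ]; field_simp; ring
  have hc0 : 0 < c := div_pos two_pos (by linarith)
  have h1 := mul_le_mul_of_nonneg_left (hlower v) hc0.le
  have h2 := mul_le_mul_of_nonneg_left (hupper v) hc0.le
  rw [abs_le]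
  constructor
  · rw [hq2]; linarith
  · rw [hq1]; linarith

theorem norm_sub_richardson_le {A : E →L[𝕜] E} (hA : A.IsSymmetric) {γ Γ : ℝ} (hγ : 0 < γ)
    (hγΓ : γ < Γ) (hlower : ∀ v, γ * ‖v‖ ^ 2 ≤ RCLike.re (inner 𝕜 v (A v)))
    (hupper : ∀ v, RCLike.re (inner 𝕜 v (A v)) ≤ Γ * ‖v‖ ^ 2) (u : E) (k : ℕ) :
    ‖u - richardson A (A u) ((2 / (γ + Γ) : ℝ) : 𝕜) k‖ ≤ ((Γ - γ) / (Γ + γ)) ^ k * ‖u‖ := by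
  have hq : 0 ≤ (Γ - γ) / (Γ + γ) := div_nonneg (by linarith) (by linarith)
  rw [sub_richardson]
  induction k with
  | zero => simp
  | succ k ih =>
    rw [pow_succ', mul_apply_eq_comp, pow_succ', mul_assoc]
    exact (ContinuousLinearMap.le_of_opNorm_le _
      (norm_one_sub_smul_le hA hγ hγΓ hlower hupper) _).trans (by gcongr)

end Richardson

/-- A power at the integer logarithm, compared with the power at the real one. -/
theorem pow_log_succ_le_one_div_rpow {q : ℝ} (hq0 : 0 < q) (hq1 : q < 1) {R r : ℕ} (hR : 1 < R)
    (hr : 1 ≤ r) :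
    q ^ (Nat.log R r + 1) ≤ (1 / (r : ℝ)) ^ |Real.log q / Real.log R| := by
  have hR' : 0 < Real.log R := Real.log_pos (by exact_mod_cast hR)
  have hr' : (0 : ℝ) < r := by exact_mod_cast hr
  have hlq : Real.log q < 0 := Real.log_neg hq0 hq1
  rw [abs_of_neg (div_neg_of_neg_of_pos hlq hR'), ← Real.rpow_natCast,
    Real.rpow_def_of_pos hq0, Real.rpow_def_of_pos (by positivity), Real.exp_le_exp, one_div,
    Real.log_inv]
  have h1 : Real.log r ≤ (Nat.log R r + 1 : ℕ) * Real.log R := by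
    rw [← Real.log_pow]
    exact Real.log_le_log hr' (by exact_mod_cast (Nat.lt_pow_succ_log_self hR r).le)
  have h2 : Real.log r / Real.log R ≤ (Nat.log R r + 1 : ℕ) := (div_le_iff₀ hR').2 h1
  -- `log q` is negative, so the lower bound on the integer exponent becomes an upper bound.
  calc Real.log q * (Nat.log R r + 1 : ℕ) ≤ Real.log q * (Real.log r / Real.log R) :=
        mul_le_mul_of_nonpos_left h2 hlq.le
    _ = -Real.log r * -(Real.log q / Real.log R) := by ring

/-! ### Rank growth along the iteration -/

namespace HilbertTensor

/-- The added one makes the affine recursion `ρ ↦ ρ + n + n * ρ` multiplicative: its right side plus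
one is `(n + 1) * (ρ + 1)`. The zero start gives `ρ + 1 = 1`. -/
theorem tRank_richardson_add_one_le {𝕜 : Type*} [RCLike 𝕜] {ι : Type*} [Fintype ι]
    [DecidableEq ι] {H : ι → Type*} [∀ i, NormedAddCommGroup (H i)]
    [∀ i, InnerProductSpace 𝕜 (H i)] (t : Finset ι) {m n : ℕ} (hmn : m ≤ n)
    (S : Fin n → (Part 𝕜 H t →L[𝕜] Part 𝕜 H t)) (T : Fin n → (Part 𝕜 H tᶜ →L[𝕜] Part 𝕜 H tᶜ))
    (x : Fin m → Part 𝕜 H t) (y : Fin m → Part 𝕜 H tᶜ) (c : 𝕜) (k : ℕ) :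
    tRank t (richardson (∑ i, tensorOp t (S i) (T i)) (∑ j, tmul t (x j) (y j)) c k) + 1 ≤
      ((n + 1 : ℕ) : ℕ∞) ^ k := by
  set A := ∑ i, tensorOp t (S i) (T i) with hA
  set b := ∑ j, tmul t (x j) (y j) with hb
  have hrb : tRank t b ≤ n := by
    refine (tRank_sum_le_card_mul t _ fun j => tRank_tmul_le t (x j) (y j)).trans ?_
    simpa using hmn
  have hrA : ∀ z, tRank t (A z) ≤ n * tRank t z := fun z => by
    rw [hA, sum_apply]
    simpa using tRank_sum_le_card_mul t _ fun i => tRank_tensorOp_le t (S i) (T i) z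
  induction k with
  | zero => simp [richardson, tRank_zero]
  | succ k ih =>
    set z := richardson A b c k with hz
    have hstep : richardson A b c (k + 1) = z + (c • b + (-c) • A z) := by
      rw [richardson, ← hz, smul_sub, neg_smul, sub_eq_add_neg]
    rw [hstep]
    calc tRank t (z + (c • b + (-c) • A z)) + 1
        ≤ tRank t z + (n + n * tRank t z) + 1 := by
          gcongr
          refine (tRank_add_le t _ _).trans ?_
          gcongr
          refine (tRank_add_le t _ _).trans ?_
          gcongr
          · exact (tRank_smul_le t _ _).trans hrb
          · exact (tRank_smul_le t _ _).trans (hrA z)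
      _ = (n + 1 : ℕ) * (tRank t z + 1) := by push_cast; ring
      _ ≤ (n + 1 : ℕ) * (n + 1 : ℕ) ^ k := by gcongr
      _ = ((n + 1 : ℕ) : ℕ∞) ^ (k + 1) := (pow_succ' _ _).symm

end HilbertTensor

/-! ### Choice of the number of steps -/

theorem theorem2 {𝕜 : Type*} [RCLike 𝕜] {d : ℕ} {H : Fin d → Type*}
    [∀ μ, NormedAddCommGroup (H μ)] [∀ μ, InnerProductSpace 𝕜 (H μ)] [∀ μ, CompleteSpace (H μ)]
    (A : HilbertTensor.Space 𝕜 H →L[𝕜] HilbertTensor.Space 𝕜 H) (hA : IsSelfAdjoint A)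
    (γ Γ : ℝ) (hγ : 0 < γ) (hγΓ : γ < Γ)
    (hlower : ∀ v, γ * ‖v‖ ^ 2 ≤ RCLike.re (inner 𝕜 v (A v)))
    (hupper : ∀ v, RCLike.re (inner 𝕜 v (A v)) ≤ Γ * ‖v‖ ^ 2)
    (t : Finset (Fin d)) (ht : 0 < t.card) (ht' : t.card < d)
    (rA rb : ℕ) (hrb : rb ≤ rA)
    (S : Fin rA → (HilbertTensor.Part 𝕜 H t →L[𝕜] HilbertTensor.Part 𝕜 H t))
    (T : Fin rA → (HilbertTensor.Part 𝕜 H tᶜ →L[𝕜] HilbertTensor.Part 𝕜 H tᶜ))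
    (hAsum : A = ∑ i, HilbertTensor.tensorOp t (S i) (T i))
    (b : HilbertTensor.Space 𝕜 H)
    (x : Fin rb → HilbertTensor.Part 𝕜 H t) (y : Fin rb → HilbertTensor.Part 𝕜 H tᶜ)
    (hbsum : b = ∑ j, HilbertTensor.tmul t (x j) (y j))
    (u : HilbertTensor.Space 𝕜 H) (hu : A u = b)
    (κ q : ℝ) (hκ : κ = Γ / γ) (hq : q = (κ - 1) / (κ + 1)) :
    (∀ r : ℕ, 1 ≤ r →
      HilbertTensor.tau t r u ≤
        ‖u‖ / q * (1 / (r : ℝ)) ^ |Real.log q / Real.log ((rA : ℝ) + 2)|) ∧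
    ((∃ i, S i = ContinuousLinearMap.id 𝕜 _ ∨ T i = ContinuousLinearMap.id 𝕜 _) →
      ∀ r : ℕ, 1 ≤ r →
        HilbertTensor.tau t r u ≤
          ‖u‖ / q * (1 / (r : ℝ)) ^ |Real.log q / Real.log ((rA : ℝ) + 1)|) := by
  have hκ1 : 1 < κ := by rwa [hκ, one_lt_div hγ]
  have hq0 : 0 < q := hq ▸ div_pos (by linarith) (by linarith)
  have hq1 : q < 1 := by rw [hq, div_lt_one (by linarith)]; linarith
  have hqΓ : q = (Γ - γ) / (Γ + γ) := by
    have : Γ + γ ≠ 0 := by linarith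
    rw [hq, hκ]
    field_simp
  -- Both claims are instances of one bound; `1 < R` keeps `log R` positive, and `rA + 1 ≤ R` covers
  -- the rank growth.
  have key : ∀ R : ℕ, 1 < R → rA + 1 ≤ R → ∀ r : ℕ, 1 ≤ r →
      HilbertTensor.tau t r u ≤
        ‖u‖ / q * (1 / (r : ℝ)) ^ |Real.log q / Real.log (R : ℝ)| := by
    intro R hR hRA r hr
    have hrank := HilbertTensor.tRank_richardson_add_one_le t hrb S T x y
      ((2 / (γ + Γ) : ℝ) : 𝕜) (Nat.log R r)
    rw [← hAsum, ← hbsum, ← hu] at hrank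
    have hpow : (rA + 1) ^ Nat.log R r ≤ r :=
      (Nat.pow_le_pow_left hRA _).trans (Nat.pow_log_le_self R (by omega))
    have hle : HilbertTensor.tRank t
        (richardson A (A u) ((2 / (γ + Γ) : ℝ) : 𝕜) (Nat.log R r)) ≤ r :=
      le_self_add.trans (hrank.trans (by exact_mod_cast hpow))
    calc HilbertTensor.tau t r u
        ≤ q ^ Nat.log R r * ‖u‖ := by
          rw [hqΓ]
          exact (HilbertTensor.tau_le_norm_sub t hle).trans
            (norm_sub_richardson_le hA.isSymmetric hγ hγΓ hlower hupper u _)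
      -- The exponent is raised by one because `r` is bounded above by `R ^ (k + 1)`, not by `R ^
      -- k`; this is the origin of the prefactor `1 / q`.
      _ = ‖u‖ / q * q ^ (Nat.log R r + 1) := by rw [pow_succ]; field_simp
      _ ≤ _ := by
          gcongr
          exact pow_log_succ_le_one_div_rpow hq0 hq1 hR hr
  constructor
  · simpa using key (rA + 2) (by omega) (by omega)
  -- The existence of the index `i` forces `rA ≥ 1`, hence `rA + 1 > 1`.
  · rintro ⟨i, -⟩
    simpa using key (rA + 1) (by have := i.pos; omega) le_rfl
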